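/- Let $G=(V,E)$ be a finite simple graph, $n=|V|$, and let $L$ be a finite set of $k$ labels. For node costs $c:V\times L\to\mathbb R$ and edge weights $w:E\to\mathbb R$, let $\theta=\theta(c,w)\in\mathbb R^{nk+|E|k^2}$ be the vector with $\theta_u(i)=c(u,i)$, $\theta_{uv}(i,j)=w(u,v)$ if $i\neq j$, and $\theta_{uv}(i,i)=0$. The local polytope $L(G)$ is the set of all $x=\big((x_u(i))_{u,i},(x_{uv}(i,j))_{uv,i,j}\big)$ with entries in $[0,1]$ such that $\sum_i x_u(i)=1$, $\sum_i x_{uv}(i,j)=x_v(j)$ and $\sum_j x_{uv}(i,j)=x_u(i)$ for all $u\in V$, $(u,v)\in E$, $i,j\in L$; and $L^*(G)$ is the set of those $x\in L(G)$ with $x_{uv}(i,i)=\min(x_u(i),x_v(i))$ for all $(u,v)\in E$, $i\in L$. A labeling $y:V\to L$ is identified with the corresponding $0/1$ point of $L(G)$; a MAP solution of $(G,c,w)$ is a labeling that minimizes $\langle\theta,y\rangle$ among all labelings, and an LP solution is a minimizer of $\langle\theta,x\rangle$ over $L(G)$. An expansion of $y$ is a labeling $z\ne y$ for which there is a label $a$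 with $z(u)\in\{a,y(u)\}$ for all $u$. The instance $(G,c,w)$ is $(2,1)$-expansion stable if it has a MAP solution $y$ such that $\langle\theta(c,w'),y\rangle<\langle\theta(c,w'),z\rangle$ for every expansion $z$ of $y$ and every $w'$ with $w/2\le w'\le w$; it is $(2,1,\psi)$-expansion stable if $(G,c',w)$ is $(2,1)$-expansion stable for every $c'$ with $c\le c'\le c+\psi$ (entrywise). Let $\psi>0$ and let $(G,\bar c,\bar w)$, $\bar w\ge 0$, be a $(2,1,\psi)$-expansion stable instance. Let $\tilde c(u,i)$ $(u\in V,\ i\in L)$ and $\tilde w(u,v)$ $((u,v)\in E)$ be jointly independent, mean-zero random variables that are sub-Gaussian with parameters $\sigma_{u,i}\ge0$ and $\gamma_{uv}\ge0$, that is, $\mathbb E\,e^{\lambda\tilde c(u,i)}\le e^{\lambda^2\sigma_{u,i}^2/2}$ and $\mathbb E\,e^{\lambda\tilde w(u,v)}\le e^{\lambda^2\gamma_{uv}^2/2}$ for all $\lambda\in\mathbb R$. Let $\hat c=\bar c+\tilde c$, $\hat w=\bar w+\tilde w$ be the observed instance, $\hat\theta=\theta(\hat c,\hat w)$, $\bar\theta=\theta(\bar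 c,\bar w)$. Let $c\ge0$ and $$B=c\sqrt{nk}\,\sqrt{\sum_{u,i}\sigma_{u,i}^2+\frac{k^2}{4}\sum_{uv\in E}\gamma_{uv}^2}.$$ Then the set $$\mathcal A=\Big\{\sup_{x\in L^*(G)}\big|\langle\hat\theta,x\rangle-\langle\bar\theta,x\rangle\big|\le B\Big\}$$ is an event, and $$\Pr[\mathcal A]\ \ge\ 1-2\exp\!\Big(nk\big(\ln 2-\tfrac{c^2}{2}\big)\Big).$$ Moreover, if the noise is truncated so that all observed weights $\hat w(u,v)$ are almost surely nonnegative, then almost surely on $\mathcal A$, for every LP solution $\hat x$ of the observed instance, every MAP solution $\bar x$ of $(G,\bar c,\bar w)$ and every MAP solution $\hat x^{MAP}$ of the observed instance, $$\tfrac12\|\hat x_V-\bar x_V\|_1\le\frac{2B}{\psi}\qquad\text{and}\qquad \tfrac12\|\hat x_V-\hat x^{MAP}_V\|_1\le\frac{2B}{\psi}+\tfrac12\|\hat x^{MAP}_V-\bar x_V\|_1,$$ where $x_V=(x_u(i))_{u\in V,i\in L}$. -/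

import Mathlib

open MeasureTheory ProbabilityTheory
open scoped NNReal

noncomputable section

namespace UniformMetricLabeling

/-- First endpoint of an (arbitrarily, but once and for all, oriented) edge. -/
def src {V : Type*} {G : SimpleGraph V} (e : G.edgeSet) : V := (Quot.out (e : Sym2 V)).1

/-- Second endpoint of an edge. -/
def tgt {V : Type*} {G : SimpleGraph V} (e : G.edgeSet) : V := (Quot.out (e : Sym2 V)).2

theorem mk_src_tgt {V : Type*} {G : SimpleGraph V} (e : G.edgeSet) :
    s(src e, tgt e) = (e : Sym2 V) :=
  Quot.out_eq (e : Sym2 V)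

theorem adj_src_tgt {V : Type*} {G : SimpleGraph V} (e : G.edgeSet) :
    G.Adj (src e) (tgt e) := by
  have h := e.2
  rw [← mk_src_tgt e] at h
  exact h

/-- The space `ℝ^(nk + mk²)` of the local LP: `x.1 u i` is `x_u(i)`, and `x.2 e i j` is
`x_{uv}(i, j)` for the edge `e = (u, v)`, `u = src e`, `v = tgt e`. -/
abbrev Point {V : Type*} (G : SimpleGraph V) (L : Type*) : Type _ :=
  (V → L → ℝ) × (G.edgeSet → L → L → ℝ)

/-- The objective vector of the instance with node costs `c` and edge weights `w`:
`θ_u(i) = c(u, i)` and `θ_{uv}(i, j) = w(u, v)` if `i ≠ j`, `0` if `i = j`. -/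
def objVec {V L : Type*} {G : SimpleGraph V} [DecidableEq L]
    (c : V → L → ℝ) (w : G.edgeSet → ℝ) : Point G L :=
  (c, fun e i j => if i = j then 0 else w e)

/-- The inner product `⟨θ, x⟩`. -/
def dot {V L : Type*} {G : SimpleGraph V} [Fintype V] [Fintype L] [Fintype G.edgeSet]
    (θ x : Point G L) : ℝ :=
  (∑ u, ∑ i, θ.1 u i * x.1 u i) + ∑ e, ∑ i, ∑ j, θ.2 e i j * x.2 e i j

/-- The feasible region `L(G)` of the local LP. -/
def localPolytope {V : Type*} (G : SimpleGraph V) (L : Type*) [Fintype L] :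
    Set (Point G L) :=
  {x | (∀ u, ∑ i, x.1 u i = 1) ∧
    (∀ e j, ∑ i, x.2 e i j = x.1 (tgt e) j) ∧
    (∀ e i, ∑ j, x.2 e i j = x.1 (src e) i) ∧
    (∀ e i j, x.2 e i j ∈ Set.Icc (0 : ℝ) 1) ∧
    (∀ u i, x.1 u i ∈ Set.Icc (0 : ℝ) 1)}

/-- `L*(G)`: the points of `L(G)` with `x_{uv}(i, i) = min (x_u(i), x_v(i))`. -/
def Lstar {V : Type*} (G : SimpleGraph V) (L : Type*) [Fintype L] :
    Set (Point G L) :=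
  {x | x ∈ localPolytope G L ∧ ∀ e i, x.2 e i i = min (x.1 (src e) i) (x.1 (tgt e) i)}

/-- The vertex of `L(G)` that corresponds to a labeling. -/
def ofLabeling {V L : Type*} (G : SimpleGraph V) [DecidableEq L] (y : V → L) : Point G L :=
  (fun u i => if y u = i then 1 else 0,
    fun e i j => if y (src e) = i ∧ y (tgt e) = j then 1 else 0)

/-- `y` is a MAP solution: a labeling of least objective value. -/
def IsMAP {V L : Type*} {G : SimpleGraph V} [Fintype V] [Fintype L] [DecidableEq L]
    [Fintype G.edgeSet]
    (c : V → L → ℝ) (w : G.edgeSet → ℝ) (y : V → L) : Prop :=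
  ∀ z : V → L, dot (objVec c w) (ofLabeling G y) ≤ dot (objVec c w) (ofLabeling G z)

/-- `x` is a solution of the local LP. -/
def IsLPSolution {V L : Type*} {G : SimpleGraph V} [Fintype V] [Fintype L] [DecidableEq L]
    [Fintype G.edgeSet]
    (c : V → L → ℝ) (w : G.edgeSet → ℝ) (x : Point G L) : Prop :=
  x ∈ localPolytope G L ∧
    ∀ z ∈ localPolytope G L, dot (objVec c w) x ≤ dot (objVec c w) z

/-- `z` is an expansion of `y`: for some label `a`, it differs from `y` only in that some vertices
(at least one) are relabeled `a`. -/
def IsExpansion {V L : Type*} (y z : V → L) : Prop :=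
  z ≠ y ∧ ∃ a : L, ∀ u, z u = a ∨ z u = y u

/-- `(2,1)`-expansion stability: the MAP solution is strictly better than each of its expansions in
every `(2,1)`-perturbation of the instance. -/
def ExpansionStable {V L : Type*} {G : SimpleGraph V} [Fintype V] [Fintype L] [DecidableEq L]
    [Fintype G.edgeSet]
    (c : V → L → ℝ) (w : G.edgeSet → ℝ) : Prop :=
  ∃ y : V → L, IsMAP c w y ∧
    ∀ w' : G.edgeSet → ℝ, (∀ e, w e / 2 ≤ w' e ∧ w' e ≤ w e) →
      ∀ z : V → L, IsExpansion y z →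
        dot (objVec c w') (ofLabeling G y) < dot (objVec c w') (ofLabeling G z)

/-- `(2,1,ψ)`-expansion stability. -/
def ExpansionStableMargin {V L : Type*} {G : SimpleGraph V} [Fintype V] [Fintype L] [DecidableEq L]
    [Fintype G.edgeSet]
    (c : V → L → ℝ) (w : G.edgeSet → ℝ) (ψ : ℝ) : Prop :=
  ∀ c' : V → L → ℝ, (∀ u i, c u i ≤ c' u i ∧ c' u i ≤ c u i + ψ) → ExpansionStable c' w

/-- `d(θ, θ') = sup_{x ∈ L*(G)} |⟨θ, x⟩ - ⟨θ', x⟩|`. -/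
def objDist {V L : Type*} {G : SimpleGraph V} [Fintype V] [Fintype L] [Fintype G.edgeSet]
    (θ θ' : Point G L) : ℝ :=
  sSup ((fun x => |dot θ x - dot θ' x|) '' Lstar G L)

/-- The supremum in `objDist` is over a bounded set, for all objective vectors. -/
theorem bddAbove_objDist {V L : Type*} {G : SimpleGraph V} [Fintype V] [Fintype L]
    [Fintype G.edgeSet] (θ θ' : Point G L) :
    BddAbove ((fun x => |dot θ x - dot θ' x|) '' Lstar G L) := by
  have key : ∀ η : Point G L, ∀ x ∈ Lstar G L,
      |dot η x| ≤ (∑ u, ∑ i, |η.1 u i|) + ∑ e, ∑ i, ∑ j, |η.2 e i j| := by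
    rintro η x ⟨⟨-, -, -, he, hv⟩, -⟩
    have aux : ∀ a b : ℝ, b ∈ Set.Icc (0 : ℝ) 1 → |a * b| ≤ |a| := by
      intro a b hb
      rw [abs_mul, abs_of_nonneg hb.1]
      exact mul_le_of_le_one_right (abs_nonneg a) hb.2
    refine (abs_add_le _ _).trans (add_le_add ?_ ?_)
    · refine (Finset.abs_sum_le_sum_abs _ _).trans (Finset.sum_le_sum fun u _ => ?_)
      exact (Finset.abs_sum_le_sum_abs _ _).trans
        (Finset.sum_le_sum fun i _ => aux _ _ (hv u i))
    · refine (Finset.abs_sum_le_sum_abs _ _).trans (Finset.sum_le_sum fun e _ => ?_)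
      refine (Finset.abs_sum_le_sum_abs _ _).trans (Finset.sum_le_sum fun i _ => ?_)
      exact (Finset.abs_sum_le_sum_abs _ _).trans
        (Finset.sum_le_sum fun j _ => aux _ _ (he e i j))
  refine ⟨((∑ u, ∑ i, |θ.1 u i|) + ∑ e, ∑ i, ∑ j, |θ.2 e i j|) +
    ((∑ u, ∑ i, |θ'.1 u i|) + ∑ e, ∑ i, ∑ j, |θ'.2 e i j|), ?_⟩
  rintro _ ⟨x, hx, rfl⟩
  have h := abs_add_le (dot θ x) (-dot θ' x)
  rw [abs_neg, ← sub_eq_add_neg] at h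
  exact h.trans (add_le_add (key θ x hx) (key θ' x hx))

/-- `‖x_V - y_V‖₁ / 2`, the distance of the node variables. -/
def nodeDist {V L : Type*} {G : SimpleGraph V} [Fintype V] [Fintype L]
    (x y : Point G L) : ℝ :=
  (∑ u, ∑ i, |x.1 u i - y.1 u i|) / 2

/-- The noise: independent, mean zero, sub-Gaussian perturbations `ct u i` (parameter `σ u i`) of
the node costs and `wt e` (parameter `γ e`) of the edge weights. -/
structure IsNoise {V L : Type*} {G : SimpleGraph V} {Ω : Type*} [MeasurableSpace Ω]
    (μ : Measure Ω) (ct : V → L → Ω → ℝ) (wt : G.edgeSet → Ω → ℝ)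
    (σ : V → L → ℝ≥0) (γ : G.edgeSet → ℝ≥0) : Prop where
  measurable_cost : ∀ u i, Measurable (ct u i)
  measurable_weight : ∀ e, Measurable (wt e)
  mean_cost : ∀ u i, ∫ ω, ct u i ω ∂μ = 0
  mean_weight : ∀ e, ∫ ω, wt e ω ∂μ = 0
  subGaussian_cost : ∀ u i, HasSubgaussianMGF (ct u i) (σ u i ^ 2) μ
  subGaussian_weight : ∀ e, HasSubgaussianMGF (wt e) (γ e ^ 2) μ
  indep : iIndepFun (Sum.elim (fun p : V × L => ct p.1 p.2) wt) μ

/-- The bound `c √(nk) √(∑ σ_{u,i}² + (k²/4) ∑ γ_{uv}²)`. -/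
def noiseBound {V L : Type*} {G : SimpleGraph V} [Fintype V] [Fintype L] [Fintype G.edgeSet]
    (c : ℝ) (σ : V → L → ℝ≥0) (γ : G.edgeSet → ℝ≥0) : ℝ :=
  c * √((Fintype.card V : ℝ) * Fintype.card L) *
    √((∑ u, ∑ i, (σ u i : ℝ) ^ 2) + (Fintype.card L : ℝ) ^ 2 / 4 * ∑ e, (γ e : ℝ) ^ 2)

/-- The observed node costs. -/
def observedCost {V L Ω : Type*} (cbar : V → L → ℝ) (ct : V → L → Ω → ℝ) (ω : Ω) : V → L → ℝ :=
  fun u i => cbar u i + ct u i ω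

/-- The observed edge weights. -/
def observedWeight {V Ω : Type*} {G : SimpleGraph V} (wbar : G.edgeSet → ℝ)
    (wt : G.edgeSet → Ω → ℝ) (ω : Ω) : G.edgeSet → ℝ :=
  fun e => wbar e + wt e ω

/-- The event that `d(θ̂, θ̄) ≤ B`, where `θ̂` is the observed and `θ̄` the latent objective. -/
def closeEvent {V L Ω : Type*} {G : SimpleGraph V} [Fintype V] [Fintype L] [DecidableEq L]
    [Fintype G.edgeSet] (cbar : V → L → ℝ) (wbar : G.edgeSet → ℝ)
    (ct : V → L → Ω → ℝ) (wt : G.edgeSet → Ω → ℝ) (B : ℝ) : Set Ω :=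
  {ω | objDist (objVec (observedCost cbar ct ω) (observedWeight wbar wt ω))
    (objVec cbar wbar) ≤ B}

end UniformMetricLabeling

end

/-! The engine is threshold rounding. For `r` uniform in [0,1), the random set of pairs (u,i) with r
< x_u(i) contains (u,i) with probability x_u(i), and contains both (u,i) and (v,j) with probability
min(x_u(i), x_v(j)). It is used twice.

Deterministic half: adding up, over all labels `a`, the expansions of `y` given by one threshold set
yields in expectation at most the LP gap of `x`, provided that edges uncut by `y` are charged only
w/2 (`sum_expand_le`). Stability makes every such expansion strictly worse, so `y` solves the LP
(`lp_tight`). With margin ψ this remains true after raising the costs of the labels of `y` by ψ,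
which turns into ψ · distance ≤ LP gap (`ExpansionStableMargin.nodeDist_le`). An observed LP
solution can be moved into L*(G) without changing its node part, and there its latent gap is at most
2B.

Probabilistic half: on L*(G) the noise objective is an average, over threshold sets, of linear forms
in the noise (`dot_sub_dot_eq_sum`). The supremum is therefore controlled by 2^(nk) sub-Gaussian
sums and a union bound. -/

noncomputable section

namespace UniformMetricLabeling

/-! ### Threshold rounding of a vector in the unit cube -/

/-- Weights on the subsets of `I` (given by their characteristic functions) that make up the
distribution of the superlevel set of `p` at a uniformly random threshold. -/
structure IsThresholdWeights {I : Type*} [Fintype I] [DecidableEq I] (p : I → ℝ)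
    (l : (I → Bool) → ℝ) : Prop where
  nonneg : ∀ s, 0 ≤ l s
  sum_eq_one : ∑ s, l s = 1
  sum_pair : ∀ i j, ∑ s, l s * (if s i ∧ s j then 1 else 0) = min (p i) (p j)

theorem IsThresholdWeights.sum_single {I : Type*} [Fintype I] [DecidableEq I] {p : I → ℝ}
    {l : (I → Bool) → ℝ} (h : IsThresholdWeights p l) (i : I) :
    ∑ s, l s * (if s i then 1 else 0) = p i := by
  simpa using h.sum_pair i i

theorem exists_isThresholdWeights {I : Type*} [Fintype I] [DecidableEq I] (p : I → ℝ)
    (hp : ∀ i, p i ∈ Set.Icc (0 : ℝ) 1) : ∃ l, IsThresholdWeights p l := by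
  let ν : Measure ℝ := volume.restrict (Set.Ico 0 1)
  let T : ℝ → I → Bool := fun r i => decide (r < p i)
  have hT : Measurable T := by
    refine measurable_pi_lambda _ fun i => ?_
    exact measurable_to_bool (by
      have : (fun r => decide (r < p i)) ⁻¹' {true} = Set.Iio (p i) := by ext; simp
      rw [this]; exact measurableSet_Iio)
  have hfib : ∀ s : I → Bool, MeasurableSet (T ⁻¹' {s}) := fun s =>
    hT (measurableSet_singleton s)
  refine ⟨fun s => ν.real (T ⁻¹' {s}), fun s => measureReal_nonneg, ?_, fun i j => ?_⟩
  · rw [sum_measureReal_preimage_singleton _ fun s _ => hfib s]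
    simp [ν]
  · simp only [mul_ite, mul_one, mul_zero]
    rw [← Finset.sum_filter, sum_measureReal_preimage_singleton _ fun s _ => hfib s]
    have : T ⁻¹' (↑(Finset.univ.filter fun s : I → Bool => s i ∧ s j) : Set (I → Bool)) =
        Set.Iio (min (p i) (p j)) := by
      ext r; simp [T]
    rw [this, measureReal_restrict_apply measurableSet_Iio]
    have h2 : Set.Iio (min (p i) (p j)) ∩ Set.Ico 0 1 = Set.Ico 0 (min (p i) (p j)) := by
      ext r
      simp only [Set.mem_inter_iff, Set.mem_Iio, Set.mem_Ico, lt_min_iff]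
      have := (hp i).2
      constructor
      · rintro ⟨h, h'⟩; exact ⟨h'.1, h⟩
      · rintro ⟨h, h'⟩; exact ⟨h', h, h'.1.trans_le this⟩
    rw [h2, Real.volume_real_Ico_of_le (le_min (hp i).1 (hp j).1), sub_zero]

/-! ### The local polytope, L*(G) and the objective -/

section LocalLP

variable {V L : Type*} {G : SimpleGraph V} [Fintype L]

theorem diag_le_min {x : Point G L} (hx : x ∈ localPolytope G L) (e : G.edgeSet) (i : L) :
    x.2 e i i ≤ min (x.1 (src e) i) (x.1 (tgt e) i) := by
  obtain ⟨-, ht, hs, he, -⟩ := hx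
  refine le_min ?_ ?_
  · rw [← hs e i]
    exact Finset.single_le_sum (f := fun j => x.2 e i j) (fun j _ => (he e i j).1)
      (Finset.mem_univ i)
  · rw [← ht e i]
    exact Finset.single_le_sum (f := fun j => x.2 e j i) (fun j _ => (he e j i).1)
      (Finset.mem_univ i)

/-- Probability vectors have a coupling whose diagonal is their minimum. -/
theorem exists_coupling_diag_min (a b : L → ℝ) (ha : ∀ i, 0 ≤ a i) (hb : ∀ i, 0 ≤ b i)
    (ha1 : ∑ i, a i = 1) (hb1 : ∑ i, b i = 1) :
    ∃ q : L → L → ℝ, (∀ i j, 0 ≤ q i j) ∧ (∀ i, ∑ j, q i j = a i) ∧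
      (∀ j, ∑ i, q i j = b j) ∧ ∀ i, q i i = min (a i) (b i) := by
  classical
  set m : L → ℝ := fun i => min (a i) (b i) with hm
  set D : ℝ := 1 - ∑ i, m i with hD
  have hma : ∀ i, 0 ≤ a i - m i := fun i => sub_nonneg.2 (min_le_left _ _)
  have hmb : ∀ i, 0 ≤ b i - m i := fun i => sub_nonneg.2 (min_le_right _ _)
  have hsa : ∑ i, (a i - m i) = D := by rw [Finset.sum_sub_distrib, ha1]
  have hsb : ∑ i, (b i - m i) = D := by rw [Finset.sum_sub_distrib, hb1]
  have hD0 : 0 ≤ D := hsa ▸ Finset.sum_nonneg fun i _ => hma i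
  have hza : D = 0 → ∀ i, a i - m i = 0 := fun h i =>
    (Finset.sum_eq_zero_iff_of_nonneg fun i _ => hma i).1 (hsa.trans h) i (Finset.mem_univ i)
  have hzb : D = 0 → ∀ i, b i - m i = 0 := fun h i =>
    (Finset.sum_eq_zero_iff_of_nonneg fun i _ => hmb i).1 (hsb.trans h) i (Finset.mem_univ i)
  -- The common mass sits on the diagonal and the excesses are coupled as a product. If D = 0 the
  -- quotient is 0 by convention, which is right because there is then no excess. On the diagonal
  -- one of the two excesses vanishes.
  refine ⟨fun i j => (if i = j then m i else 0) + (a i - m i) * (b j - m j) / D, ?_, ?_, ?_, ?_⟩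
  · intro i j
    have h1 : 0 ≤ if i = j then m i else 0 := by
      split_ifs
      · exact le_min (ha i) (hb i)
      · exact le_rfl
    have := mul_nonneg (hma i) (hmb j)
    positivity
  · intro i
    rw [Finset.sum_add_distrib, ← Finset.sum_div, ← Finset.mul_sum, hsb]
    rcases eq_or_ne D 0 with h | h
    · have := hza h i
      simp [h]; linarith
    · rw [mul_div_cancel_right₀ _ h]; simp
  · intro j
    rw [Finset.sum_add_distrib, ← Finset.sum_div, ← Finset.sum_mul, hsa]
    rcases eq_or_ne D 0 with h | h
    · have := hzb h j
      simp [h]; linarith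
    · rw [mul_div_cancel_left₀ _ h]; simp
  · intro i
    have : (a i - m i) * (b i - m i) = 0 := by
      rcases min_choice (a i) (b i) with h | h
      · rw [show m i = a i from h]; simp
      · rw [show m i = b i from h]; simp
    beta_reduce
    rw [if_pos rfl, this, zero_div, add_zero]

theorem exists_mem_Lstar {x : Point G L} (hx : x ∈ localPolytope G L) :
    ∃ x' ∈ Lstar G L, x'.1 = x.1 := by
  obtain ⟨h1, -, -, -, hv⟩ := hx
  choose q hq0 hqa hqb hqd using fun e : G.edgeSet =>
    exists_coupling_diag_min (x.1 (src e)) (x.1 (tgt e)) (fun i => (hv _ i).1)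
      (fun i => (hv _ i).1) (h1 _) (h1 _)
  refine ⟨(x.1, q), ⟨⟨h1, hqb, hqa, fun e i j => ⟨hq0 e i j, ?_⟩, hv⟩, hqd⟩, rfl⟩
  calc q e i j ≤ ∑ j, q e i j :=
        Finset.single_le_sum (f := fun j => q e i j) (fun j _ => hq0 e i j) (Finset.mem_univ j)
    _ ≤ 1 := hqa e i ▸ (hv _ i).2

theorem ofLabeling_mem_Lstar [DecidableEq L] (y : V → L) : ofLabeling G y ∈ Lstar G L := by
  refine ⟨⟨fun u => ?_, fun e j => ?_, fun e i => ?_, fun e i j => ?_, fun u i => ?_⟩,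
    fun e i => ?_⟩
  · simp [ofLabeling]
  · simp [ofLabeling, ite_and]
  · simp only [ofLabeling, ite_and]; split_ifs <;> simp
  · simp only [ofLabeling]; split_ifs <;> simp
  · simp only [ofLabeling]; split_ifs <;> simp
  · simp only [ofLabeling]
    by_cases h1 : y (src e) = i <;> by_cases h2 : y (tgt e) = i <;> simp [h1, h2]

variable [Fintype V]

theorem nodeDist_self (x : Point G L) : nodeDist x x = 0 := by simp [nodeDist]

theorem nodeDist_triangle (x y z : Point G L) : nodeDist x y ≤ nodeDist x z + nodeDist y z := by
  simp only [nodeDist, ← add_div, ← Finset.sum_add_distrib]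
  gcongr with u _ i _
  rw [abs_sub_comm (y.1 u i)]
  exact abs_sub_le _ _ _

theorem abs_dot_sub_le_objDist [Fintype G.edgeSet] {θ θ' x : Point G L} (hx : x ∈ Lstar G L) :
    |dot θ x - dot θ' x| ≤ objDist θ θ' :=
  le_csSup (bddAbove_objDist θ θ') ⟨x, hx, rfl⟩

variable [DecidableEq L]

theorem nodeDist_ofLabeling {x : Point G L} (hx : x ∈ localPolytope G L) (y : V → L) :
    nodeDist x (ofLabeling G y) = ∑ u, (1 - x.1 u (y u)) := by
  rw [nodeDist, Finset.sum_div]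
  refine Finset.sum_congr rfl fun u _ => ?_
  have h1 := hx.1 u
  have h : ∀ i, |x.1 u i - (ofLabeling G y).1 u i| =
      x.1 u i + if y u = i then 1 - 2 * x.1 u i else 0 := by
    intro i
    obtain ⟨h0, h1⟩ := hx.2.2.2.2 u i
    simp only [ofLabeling]
    split_ifs
    · rw [abs_of_nonpos (by linarith)]; ring
    · rw [sub_zero, abs_of_nonneg h0]; ring
  simp only [h, Finset.sum_add_distrib, h1]
  simp
  ring

theorem nodeDist_ofLabeling_pos {y z : V → L} (h : z ≠ y) :
    0 < nodeDist (ofLabeling G z) (ofLabeling G y) := by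
  rw [nodeDist_ofLabeling (ofLabeling_mem_Lstar z).1]
  obtain ⟨u, hu⟩ := Function.ne_iff.1 h
  refine Finset.sum_pos' (fun v _ => ?_) ⟨u, Finset.mem_univ u, by simp [ofLabeling, hu]⟩
  simp only [ofLabeling]
  split_ifs <;> simp

variable [Fintype G.edgeSet]

/-- Each edge table has total mass 1, so its off-diagonal mass is 1 minus its trace. -/
theorem dot_objVec {x : Point G L} (hx : x ∈ localPolytope G L) (c : V → L → ℝ)
    (w : G.edgeSet → ℝ) :
    dot (objVec c w) x = (∑ u, ∑ i, c u i * x.1 u i) + ∑ e, w e * (1 - ∑ i, x.2 e i i) := by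
  simp only [dot, objVec]
  congr 1
  refine Finset.sum_congr rfl fun e _ => ?_
  have h1 : ∑ i, ∑ j, x.2 e i j = 1 := by
    rw [← hx.1 (src e)]
    exact Finset.sum_congr rfl fun i _ => hx.2.2.1 e i
  rw [← h1, ← Finset.sum_sub_distrib, Finset.mul_sum]
  refine Finset.sum_congr rfl fun i _ => ?_
  rw [mul_sub, Finset.mul_sum, eq_sub_iff_add_eq]
  have : w e * x.2 e i i = ∑ j, if i = j then w e * x.2 e i j else 0 := by simp
  rw [this, ← Finset.sum_add_distrib]
  exact Finset.sum_congr rfl fun j _ => by split_ifs <;> simp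

theorem dot_objVec_ofLabeling (y : V → L) (c : V → L → ℝ) (w : G.edgeSet → ℝ) :
    dot (objVec c w) (ofLabeling G y) =
      (∑ u, c u (y u)) + ∑ e, w e * (if y (src e) = y (tgt e) then 0 else 1) := by
  rw [dot_objVec (ofLabeling_mem_Lstar y).1]
  congr 1
  · simp [ofLabeling]
  · refine Finset.sum_congr rfl fun e _ => ?_
    congr 1
    simp only [ofLabeling, ite_and]
    simp only [Finset.sum_ite_eq, Finset.mem_univ, if_true, eq_comm (a := y (tgt e))]
    split_ifs <;> simp

/-- The minimum of the two node values is the largest diagonal entry the marginals allow, hence the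
cheapest for a nonnegative weight. This is where nonnegativity of the observed weights enters. -/
theorem dot_Lstar_le {x x' : Point G L} (hx : x ∈ localPolytope G L) (hx' : x' ∈ Lstar G L)
    (h : x'.1 = x.1) (c : V → L → ℝ) (w : G.edgeSet → ℝ) (hw : ∀ e, 0 ≤ w e) :
    dot (objVec c w) x' ≤ dot (objVec c w) x := by
  rw [dot_objVec hx, dot_objVec hx'.1, h]
  gcongr with e _ i _
  · exact hw e
  · rw [hx'.2 e i, h]; exact diag_le_min hx e i

end LocalLP

/-! ### Rounding to expansions, and tightness of the LP for stable instances -/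

section Rounding

variable {V L : Type*}

/-- The labeling `y` with label `a` given to all `u` with `(u, a)` in `s`. -/
def expand (y : V → L) (s : V × L → Bool) (a : L) : V → L :=
  fun u => if s (u, a) then a else y u

theorem isExpansion_expand {y : V → L} {s : V × L → Bool} {a : L} (h : expand y s a ≠ y) :
    IsExpansion y (expand y s a) := by
  refine ⟨h, a, fun u => ?_⟩
  simp only [expand]
  split_ifs <;> simp

variable {G : SimpleGraph V} [DecidableEq L]

/-- The weights, between `w / 2` and `w`, that favour the expansions of `y` most. -/
def worstWeight (w : G.edgeSet → ℝ) (y : V → L) : G.edgeSet → ℝ :=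
  fun e => if y (src e) = y (tgt e) then w e / 2 else w e

theorem worstWeight_mem {w : G.edgeSet → ℝ} (hw : ∀ e, 0 ≤ w e) (y : V → L) (e : G.edgeSet) :
    w e / 2 ≤ worstWeight w y e ∧ worstWeight w y e ≤ w e := by
  have := hw e
  simp only [worstWeight]
  split_ifs <;> constructor <;> linarith

variable [Fintype V] [Fintype L] [Fintype G.edgeSet]

/-- Randomized rounding of a feasible point to expansions of `y`. -/
theorem sum_expand_le [DecidableEq V] {x : Point G L} (hx : x ∈ localPolytope G L) {l : (V × L → Bool) → ℝ}
    (hl : IsThresholdWeights (fun p : V × L => x.1 p.1 p.2) l)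
    (c : V → L → ℝ) (w : G.edgeSet → ℝ) (hw : ∀ e, 0 ≤ w e) (y : V → L) :
    ∑ s, l s * ∑ a, (dot (objVec c (worstWeight w y)) (ofLabeling G (expand y s a)) -
        dot (objVec c (worstWeight w y)) (ofLabeling G y)) ≤
      dot (objVec c w) x - dot (objVec c w) (ofLabeling G y) := by
  have hnode : ∀ u, ∑ s, l s * ∑ a, (c u (expand y s a u) - c u (y u)) =
      ∑ i, c u i * x.1 u i - c u (y u) := by
    intro u
    simp only [Finset.mul_sum]
    rw [Finset.sum_comm]
    have : ∀ a, ∑ s, l s * (c u (expand y s a u) - c u (y u)) =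
        c u a * x.1 u a - c u (y u) * x.1 u a := by
      intro a
      rw [← hl.sum_single (u, a), Finset.mul_sum, Finset.mul_sum, ← Finset.sum_sub_distrib]
      refine Finset.sum_congr rfl fun s _ => ?_
      simp only [expand]
      split_ifs <;> ring
    simp only [this, Finset.sum_sub_distrib, ← Finset.mul_sum, hx.1 u, mul_one]
  have hedge : ∀ e, ∑ s, l s * ∑ a, (worstWeight w y e *
        (if expand y s a (src e) = expand y s a (tgt e) then 0 else 1) -
        worstWeight w y e * (if y (src e) = y (tgt e) then 0 else 1)) ≤
      w e * (1 - ∑ i, x.2 e i i) - w e * (if y (src e) = y (tgt e) then 0 else 1) := by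
    intro e
    simp only [Finset.mul_sum]
    rw [Finset.sum_comm]
    have hmin : ∑ i, x.2 e i i ≤ ∑ i, min (x.1 (src e) i) (x.1 (tgt e) i) :=
      Finset.sum_le_sum fun i _ => diag_le_min hx e i
    by_cases hy : y (src e) = y (tgt e)
    -- An uncut edge can be cut only if exactly one endpoint is relabeled, which has probability
    -- x_u(a) + x_v(a) - 2 min. These sum over `a` to 2(1 - ∑ min), and the weight w/2 cancels the
    -- factor 2.
    · have h : ∀ a, ∑ s, l s * (worstWeight w y e *
          (if expand y s a (src e) = expand y s a (tgt e) then 0 else 1) -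
          worstWeight w y e * (if y (src e) = y (tgt e) then 0 else 1)) ≤
          w e / 2 * (x.1 (src e) a + x.1 (tgt e) a
            - 2 * min (x.1 (src e) a) (x.1 (tgt e) a)) := by
        intro a
        rw [← hl.sum_pair (src e, a) (tgt e, a), ← hl.sum_single (src e, a),
          ← hl.sum_single (tgt e, a), Finset.mul_sum, ← Finset.sum_add_distrib,
          ← Finset.sum_sub_distrib, Finset.mul_sum]
        refine Finset.sum_le_sum fun s _ => ?_
        have h0 := mul_nonneg (hl.nonneg s) (hw e)
        simp only [worstWeight, if_pos hy, expand]
        by_cases h1 : s (src e, a) <;> by_cases h2 : s (tgt e, a) <;>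
          simp [h1, h2, hy] <;> (try split_ifs) <;> nlinarith
      refine (Finset.sum_le_sum fun a _ => h a).trans ?_
      rw [← Finset.mul_sum, Finset.sum_sub_distrib, Finset.sum_add_distrib, hx.1, hx.1,
        ← Finset.mul_sum, if_pos hy]
      nlinarith [mul_le_mul_of_nonneg_left hmin (hw e)]
    -- A cut edge is healed whenever both endpoints take `a`, with probability min; any other change
    -- can only lower the cost.
    · have h : ∀ a, ∑ s, l s * (worstWeight w y e *
          (if expand y s a (src e) = expand y s a (tgt e) then 0 else 1) -
          worstWeight w y e * (if y (src e) = y (tgt e) then 0 else 1)) ≤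
          -w e * min (x.1 (src e) a) (x.1 (tgt e) a) := by
        intro a
        rw [← hl.sum_pair (src e, a) (tgt e, a), Finset.mul_sum]
        refine Finset.sum_le_sum fun s _ => ?_
        have h0 := mul_nonneg (hl.nonneg s) (hw e)
        simp only [worstWeight, if_neg hy, expand]
        by_cases h1 : s (src e, a) <;> by_cases h2 : s (tgt e, a) <;>
          simp [h1, h2, hy] <;> (try split_ifs) <;> nlinarith
      refine (Finset.sum_le_sum fun a _ => h a).trans ?_
      rw [← Finset.mul_sum, if_neg hy]
      nlinarith [mul_le_mul_of_nonneg_left hmin (hw e)]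
  calc _ = (∑ u, ∑ s, l s * ∑ a, (c u (expand y s a u) - c u (y u))) +
        ∑ e, ∑ s, l s * ∑ a, (worstWeight w y e *
          (if expand y s a (src e) = expand y s a (tgt e) then 0 else 1) -
          worstWeight w y e * (if y (src e) = y (tgt e) then 0 else 1)) := by
        rw [Finset.sum_comm (s := Finset.univ (α := V)),
          Finset.sum_comm (s := Finset.univ (α := G.edgeSet)), ← Finset.sum_add_distrib]
        refine Finset.sum_congr rfl fun s _ => ?_
        rw [← Finset.mul_sum, ← Finset.mul_sum, ← mul_add,
          Finset.sum_comm (s := Finset.univ (α := V)),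
          Finset.sum_comm (s := Finset.univ (α := G.edgeSet)), ← Finset.sum_add_distrib]
        congr 1
        refine Finset.sum_congr rfl fun a _ => ?_
        rw [dot_objVec_ofLabeling, dot_objVec_ofLabeling, Finset.sum_sub_distrib,
          Finset.sum_sub_distrib]
        ring
    _ ≤ (∑ u, (∑ i, c u i * x.1 u i - c u (y u))) + ∑ e, (w e * (1 - ∑ i, x.2 e i i) -
          w e * (if y (src e) = y (tgt e) then 0 else 1)) :=
        add_le_add (Finset.sum_le_sum fun u _ => (hnode u).le)
          (Finset.sum_le_sum fun e _ => hedge e)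
    _ = _ := by
        rw [dot_objVec hx, dot_objVec_ofLabeling, Finset.sum_sub_distrib,
          Finset.sum_sub_distrib]
        ring

variable {c : V → L → ℝ} {w : G.edgeSet → ℝ} {y : V → L}

/-- A labeling that beats its expansions in all `(2,1)`-perturbations is an LP solution, and every
LP solution has its node variables. -/
theorem lp_tight (hw : ∀ e, 0 ≤ w e)
    (hy : ∀ w' : G.edgeSet → ℝ, (∀ e, w e / 2 ≤ w' e ∧ w' e ≤ w e) →
      ∀ z : V → L, IsExpansion y z →
        dot (objVec c w') (ofLabeling G y) < dot (objVec c w') (ofLabeling G z))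
    {x : Point G L} (hx : x ∈ localPolytope G L) :
    dot (objVec c w) (ofLabeling G y) ≤ dot (objVec c w) x ∧
      ∀ u i, 0 < x.1 u i → i ≠ y u →
        dot (objVec c w) (ofLabeling G y) < dot (objVec c w) x := by
  classical
  obtain ⟨l, hl⟩ := exists_isThresholdWeights (fun p : V × L => x.1 p.1 p.2)
    fun p => hx.2.2.2.2 p.1 p.2
  have hround := sum_expand_le hx hl c w hw y
  have hpos : ∀ s a, expand y s a ≠ y →
      0 < dot (objVec c (worstWeight w y)) (ofLabeling G (expand y s a)) -
        dot (objVec c (worstWeight w y)) (ofLabeling G y) := fun s a h =>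
    sub_pos.2 (hy _ (worstWeight_mem hw y) _ (isExpansion_expand h))
  have hnn : ∀ s a, 0 ≤ dot (objVec c (worstWeight w y)) (ofLabeling G (expand y s a)) -
        dot (objVec c (worstWeight w y)) (ofLabeling G y) := by
    intro s a
    by_cases h : expand y s a = y
    · rw [h, sub_self]
    · exact (hpos s a h).le
  have hterm : ∀ s, 0 ≤ l s * ∑ a,
      (dot (objVec c (worstWeight w y)) (ofLabeling G (expand y s a)) -
        dot (objVec c (worstWeight w y)) (ofLabeling G y)) := fun s =>
    mul_nonneg (hl.nonneg s) (Finset.sum_nonneg fun a _ => hnn s a)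
  constructor
  · have := Finset.sum_nonneg fun s (_ : s ∈ Finset.univ) => hterm s
    linarith
  · intro u i hui hiy
    -- Since x_u(i) is positive, some threshold set of positive weight contains (u,i); its expansion
    -- by `i` moves `u` and so contributes strictly.
    obtain ⟨s, -, hs⟩ : ∃ s ∈ Finset.univ, 0 < l s * (if s (u, i) then 1 else 0) := by
      by_contra! h
      have := hl.sum_single (u, i) ▸ Finset.sum_nonpos h
      exact absurd hui (not_lt.2 this)
    have hsi : s (u, i) = true := by
      by_contra h
      simp [h] at hs
    rw [if_pos hsi, mul_one] at hs
    have hne : expand y s i ≠ y := fun h => hiy (by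
      have := congrFun h u
      simpa [expand, hsi] using this)
    have h1 : 0 < ∑ s, l s * ∑ a,
        (dot (objVec c (worstWeight w y)) (ofLabeling G (expand y s a)) -
        dot (objVec c (worstWeight w y)) (ofLabeling G y)) :=
      Finset.sum_pos' (fun s _ => hterm s) ⟨s, Finset.mem_univ s, mul_pos hs
        (Finset.sum_pos' (fun a _ => hnn s a) ⟨i, Finset.mem_univ i, hpos s i hne⟩)⟩
    linarith

/-- Another labeling puts mass 1 on some label not chosen by `y₀`, so the strict part of `lp_tight`
applies to it. -/
theorem ExpansionStable.isMAP_unique (hw : ∀ e, 0 ≤ w e) (h : ExpansionStable c w)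
    {y z : V → L} (hy : IsMAP c w y) (hz : IsMAP c w z) : y = z := by
  obtain ⟨y₀, -, h₀⟩ := h
  have key : ∀ z : V → L, IsMAP c w z → z = y₀ := by
    intro z hz
    by_contra hne
    obtain ⟨u, hu⟩ := Function.ne_iff.1 hne
    have := (lp_tight hw h₀ (ofLabeling_mem_Lstar z).1).2 u (z u) (by simp [ofLabeling]) hu
    exact absurd (hz y₀) (not_le.2 this)
  rw [key y hy, key z hz]

theorem ExpansionStable.isMAP_le (hw : ∀ e, 0 ≤ w e) (h : ExpansionStable c w)
    (hy : IsMAP c w y) {x : Point G L} (hx : x ∈ localPolytope G L) :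
    dot (objVec c w) (ofLabeling G y) ≤ dot (objVec c w) x := by
  obtain ⟨y₀, -, h₀⟩ := h
  exact (hy y₀).trans (lp_tight hw h₀ hx).1

/-! ### From the margin ψ to a bound on the distance -/

/-- The cost of the nodes with the label of `y` is raised by `t`. -/
def raiseCost (c : V → L → ℝ) (y : V → L) (t : ℝ) : V → L → ℝ :=
  fun u i => c u i + if y u = i then t else 0

theorem dot_raiseCost {x : Point G L} (hx : x ∈ localPolytope G L) (y : V → L) (t : ℝ) :
    dot (objVec (raiseCost c y t) w) x =
      dot (objVec c w) x + t * (Fintype.card V - nodeDist x (ofLabeling G y)) := by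
  have h : ∑ u, ∑ i, raiseCost c y t u i * x.1 u i =
      (∑ u, ∑ i, c u i * x.1 u i) + t * ∑ u, x.1 u (y u) := by
    rw [Finset.mul_sum, ← Finset.sum_add_distrib]
    refine Finset.sum_congr rfl fun u _ => ?_
    simp [raiseCost, add_mul, Finset.sum_add_distrib, ite_mul]
  rw [dot_objVec hx, dot_objVec hx, h, nodeDist_ofLabeling hx, Finset.sum_sub_distrib]
  simp
  ring

/-- In a `(2,1,ψ)`-expansion stable instance the MAP solution remains MAP when the costs of its
labels are raised by `ψ`. -/
theorem ExpansionStableMargin.isMAP_raiseCost (hw : ∀ e, 0 ≤ w e) {ψ : ℝ} (hψ : 0 < ψ)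
    (h : ExpansionStableMargin c w ψ) (hy : IsMAP c w y) :
    IsMAP (raiseCost c y ψ) w y := by
  classical
  by_contra hnot
  simp only [IsMAP, not_forall, not_le] at hnot
  obtain ⟨z₁, hz₁⟩ := hnot
  have hz₁y : z₁ ≠ y := by rintro rfl; exact lt_irrefl _ hz₁
  let N : (V → L) → ℝ := fun z => nodeDist (ofLabeling G z) (ofLabeling G y)
  let D : (V → L) → ℝ := fun z =>
    dot (objVec c w) (ofLabeling G z) - dot (objVec c w) (ofLabeling G y)
  have hdiff : ∀ t z, dot (objVec (raiseCost c y t) w) (ofLabeling G z) -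
      dot (objVec (raiseCost c y t) w) (ofLabeling G y) = D z - t * N z := by
    intro t z
    rw [dot_raiseCost (ofLabeling_mem_Lstar z).1, dot_raiseCost (ofLabeling_mem_Lstar y).1,
      nodeDist_self]
    simp only [D, N]; ring
  have hN : ∀ z, z ≠ y → 0 < N z := fun z hz => nodeDist_ofLabeling_pos hz
  -- D z / N z is the raise at which `z` ties with `y`; the minimum is the first tie, and `z₁`
  -- forces it to occur by ψ. There `y` and `z₀` are both MAP, against uniqueness in an instance
  -- that the margin still covers.
  obtain ⟨z₀, hz₀, hmin⟩ := Finset.exists_min_image (Finset.univ.filter fun z => z ≠ y)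
    (fun z => D z / N z) ⟨z₁, by simpa using hz₁y⟩
  simp only [Finset.mem_filter, Finset.mem_univ, true_and] at hz₀ hmin
  set t := D z₀ / N z₀ with ht
  have ht0 : 0 ≤ t := div_nonneg (sub_nonneg.2 (hy z₀)) (hN z₀ hz₀).le
  have htψ : t ≤ ψ := by
    refine (hmin z₁ hz₁y).trans ((div_le_iff₀ (hN z₁ hz₁y)).2 ?_)
    have := hdiff ψ z₁
    linarith
  have htie : D z₀ - t * N z₀ = 0 := by
    rw [ht, div_mul_cancel₀ _ (hN z₀ hz₀).ne', sub_self]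
  have hyt : IsMAP (raiseCost c y t) w y := by
    intro z
    by_cases hz : z = y
    · rw [hz]
    · have h1 := (le_div_iff₀ (hN z hz)).1 (hmin z hz)
      have h2 := hdiff t z
      linarith
  have hz₀t : IsMAP (raiseCost c y t) w z₀ := by
    intro z
    have h1 := hdiff t z₀
    have h2 := hyt z
    linarith
  refine hz₀ (ExpansionStable.isMAP_unique hw (h (raiseCost c y t) fun u i => ?_) hz₀t hyt)
  simp only [raiseCost]
  split_ifs <;> constructor <;> linarith

/-- In the raised instance `y` is optimal for the LP. The raise costs `y` the full ψn but costs `x`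
only ψ(n - distance), and the difference must already be present in the original gap. -/
theorem ExpansionStableMargin.nodeDist_le (hw : ∀ e, 0 ≤ w e) {ψ : ℝ} (hψ : 0 < ψ)
    (h : ExpansionStableMargin c w ψ) (hy : IsMAP c w y) {x : Point G L}
    (hx : x ∈ localPolytope G L) :
    ψ * nodeDist x (ofLabeling G y) ≤
      dot (objVec c w) x - dot (objVec c w) (ofLabeling G y) := by
  have hst : ExpansionStable (raiseCost c y ψ) w := h _ fun u i => by
    simp only [raiseCost]
    split_ifs <;> constructor <;> linarith
  have := hst.isMAP_le hw (h.isMAP_raiseCost hw hψ hy) hx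
  rw [dot_raiseCost hx, dot_raiseCost (ofLabeling_mem_Lstar y).1, nodeDist_self] at this
  linarith

/-- LP solutions of an instance close to a `(2,1,ψ)`-expansion stable instance are close to the MAP
solution of the latter. -/
theorem ExpansionStableMargin.nodeDist_lpSolution_le (hw : ∀ e, 0 ≤ w e) {ψ : ℝ} (hψ : 0 < ψ)
    (h : ExpansionStableMargin c w ψ) (hy : IsMAP c w y) {c' : V → L → ℝ} {w' : G.edgeSet → ℝ}
    (hw' : ∀ e, 0 ≤ w' e) {B : ℝ} (hB : objDist (objVec c' w') (objVec c w) ≤ B)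
    {x : Point G L} (hx : IsLPSolution c' w' x) :
    nodeDist x (ofLabeling G y) ≤ 2 / ψ * B := by
  obtain ⟨x', hx', hxx'⟩ := exists_mem_Lstar hx.1
  have h1 := abs_le.1 ((abs_dot_sub_le_objDist hx').trans hB)
  have h2 := abs_le.1 ((abs_dot_sub_le_objDist (ofLabeling_mem_Lstar y)).trans hB)
  have h3 := dot_Lstar_le hx.1 hx' hxx' c' w' hw'
  have h4 := hx.2 _ (ofLabeling_mem_Lstar y).1
  have h5 := h.nodeDist_le hw hψ hy hx'.1
  have h6 : nodeDist x (ofLabeling G y) = nodeDist x' (ofLabeling G y) := by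
    simp only [nodeDist, hxx']
  rw [h6, div_mul_eq_mul_div, le_div_iff₀ hψ]
  -- With θ̂ observed and θ̄ latent: θ̄·x' ≤ θ̂·x' + B ≤ θ̂·x + B ≤ θ̂·y + B ≤ θ̄·y + 2B.
  linarith

end Rounding

/-! ### Tails of weighted sums of independent sub-Gaussian variables -/

section SubGaussian

variable {Ω : Type*} [MeasurableSpace Ω] {μ : Measure Ω}

theorem measureReal_lt_abs_le_of_hasSubgaussianMGF [IsFiniteMeasure μ] {X : Ω → ℝ} {v : ℝ≥0}
    (h : HasSubgaussianMGF X v μ) {S : ℝ} (hv : v ≤ S) {t : ℝ} (ht : 0 ≤ t) :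
    μ.real {ω | t * √S < |X ω|} ≤ 2 * Real.exp (-t ^ 2 / 2) := by
  have hS : 0 ≤ S := v.2.trans hv
  have hB : 0 ≤ t * √S := mul_nonneg ht (Real.sqrt_nonneg S)
  -- For `v = 0` the Chernoff exponent divides by zero and gives only the trivial bound. Instead X
  -- vanishes almost surely, and the strict inequality makes the event null even at threshold 0.
  rcases eq_or_ne v 0 with rfl | hv0
  · have h0 : μ {ω | t * √S < |X ω|} = 0 := by
      refine measure_mono_null (fun ω hω => ?_) (ae_iff.1 h.ae_eq_zero_of_hasSubgaussianMGF_zero)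
      exact abs_pos.1 (hB.trans_lt hω)
    rw [measureReal_def, h0]
    simp only [ENNReal.toReal_zero]
    positivity
  · have hvpos : (0 : ℝ) < v := lt_of_le_of_ne v.2 fun h => hv0 (NNReal.eq h.symm)
    have hexp : Real.exp (-(t * √S) ^ 2 / (2 * v)) ≤ Real.exp (-t ^ 2 / 2) := by
      rw [Real.exp_le_exp, mul_pow, Real.sq_sqrt hS, neg_div, neg_div, neg_le_neg_iff,
        div_le_div_iff₀ two_pos (by positivity)]
      nlinarith [mul_le_mul_of_nonneg_left hv (sq_nonneg t)]
    have hsub : {ω | t * √S < |X ω|} ⊆ {ω | t * √S ≤ X ω} ∪ {ω | t * √S ≤ (-X) ω} := by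
      intro ω hω
      rcases lt_abs.1 (Set.mem_ofPred_eq ▸ hω) with h | h
      · exact Or.inl h.le
      · exact Or.inr h.le
    have h1 := (h.measure_ge_le hB).trans hexp
    have h2 := (h.neg.measure_ge_le hB).trans hexp
    linarith [(measureReal_mono (μ := μ) hsub).trans (measureReal_union_le _ _)]

theorem hasSubgaussianMGF_sum_mul {ι : Type*} [Fintype ι] {X : ι → Ω → ℝ} {v : ι → ℝ≥0}
    (hindep : iIndepFun X μ) (h : ∀ p, HasSubgaussianMGF (X p) (v p) μ) (a : ι → ℝ) :
    HasSubgaussianMGF (fun ω => ∑ p, a p * X p ω)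
      (∑ p, NNReal.mk (a p ^ 2) (sq_nonneg (a p)) * v p) μ :=
  HasSubgaussianMGF.sum_of_iIndepFun
    (hindep.comp (fun p x => a p * x) fun p => measurable_const_mul (a p))
    fun p _ => (h p).const_mul (a p)

end SubGaussian

/-! ### Uniform control of the noise over L*(G) -/

section Concentration

variable {V L : Type*} {G : SimpleGraph V} [Fintype L]

/-- The multiplicities with which the entries of `(c, w)` occur in the objective value of a set
of pairs `(u, i)`, taken as an assignment of labels with no condition at the vertices. -/
def setCoeff (G : SimpleGraph V) (s : V × L → Bool) : V × L ⊕ G.edgeSet → ℝ :=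
  Sum.elim (fun p => if s p then 1 else 0) fun e =>
    (∑ i, ((if s (src e, i) then 1 else 0) + (if s (tgt e, i) then 1 else 0) -
      2 * if s (src e, i) ∧ s (tgt e, i) then 1 else 0)) / 2

theorem setCoeff_inl_sq_le (s : V × L → Bool) (p : V × L) : setCoeff G s (.inl p) ^ 2 ≤ 1 := by
  simp only [setCoeff, Sum.elim_inl]
  split_ifs <;> simp

/-- Each summand indicates that exactly one of the two pairs is in `s`, so half the sum lies in [0,
k/2]; this is the source of the factor k²/4. -/
theorem setCoeff_inr_sq_le (s : V × L → Bool) (e : G.edgeSet) :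
    setCoeff G s (.inr e) ^ 2 ≤ (Fintype.card L : ℝ) ^ 2 / 4 := by
  have h : ∀ i, 0 ≤ ((if s (src e, i) then 1 else 0) + (if s (tgt e, i) then 1 else 0) -
      2 * if s (src e, i) ∧ s (tgt e, i) then 1 else 0 : ℝ) ∧
      ((if s (src e, i) then 1 else 0) + (if s (tgt e, i) then 1 else 0) -
      2 * if s (src e, i) ∧ s (tgt e, i) then 1 else 0 : ℝ) ≤ 1 := by
    intro i
    by_cases h1 : s (src e, i) <;> by_cases h2 : s (tgt e, i) <;> simp [h1, h2]; norm_num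
  have h0 : 0 ≤ setCoeff G s (.inr e) :=
    div_nonneg (Finset.sum_nonneg fun i _ => (h i).1) two_pos.le
  have h1 : setCoeff G s (.inr e) ≤ Fintype.card L / 2 := by
    refine div_le_div_of_nonneg_right ?_ two_pos.le
    simpa using Finset.sum_le_sum fun i (_ : i ∈ Finset.univ) => (h i).2
  nlinarith

variable [Fintype V] [Fintype G.edgeSet]

/-- `0 ≤ B` covers an empty L*(G), where the real supremum takes the default value 0. -/
theorem objDist_le_iff {θ θ' : Point G L} {B : ℝ} (hB : 0 ≤ B) :
    objDist θ θ' ≤ B ↔ ∀ x ∈ Lstar G L, |dot θ x - dot θ' x| ≤ B := by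
  refine ⟨fun h x hx => (abs_dot_sub_le_objDist hx).trans h, fun h => Real.sSup_le ?_ hB⟩
  rintro _ ⟨x, hx, rfl⟩
  exact h x hx

theorem noiseBound_nonneg {c : ℝ} (hc : 0 ≤ c) (σ : V → L → ℝ≥0) (γ : G.edgeSet → ℝ≥0) :
    0 ≤ noiseBound c σ γ := by
  unfold noiseBound; positivity

variable [DecidableEq L]

theorem dot_sub_dot {x : Point G L} (hx : x ∈ localPolytope G L) (c c' : V → L → ℝ)
    (w w' : G.edgeSet → ℝ) :
    dot (objVec c' w') x - dot (objVec c w) x =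
      (∑ u, ∑ i, (c' u i - c u i) * x.1 u i) + ∑ e, (w' e - w e) * (1 - ∑ i, x.2 e i i) := by
  simp only [dot_objVec hx, sub_mul, Finset.sum_sub_distrib]
  ring

/-- The difference of two objectives at a point of `L*(G)` is an average of its values at sets. -/
theorem dot_sub_dot_eq_sum [DecidableEq V] {x : Point G L} (hx : x ∈ Lstar G L)
    {l : (V × L → Bool) → ℝ} (hl : IsThresholdWeights (fun p : V × L => x.1 p.1 p.2) l)
    (c c' : V → L → ℝ) (w w' : G.edgeSet → ℝ) :
    dot (objVec c' w') x - dot (objVec c w) x =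
      ∑ s, l s * ∑ p, setCoeff G s p *
        Sum.elim (fun p : V × L => c' p.1 p.2 - c p.1 p.2) (fun e => w' e - w e) p := by
  have hnode : ∀ p : V × L, ∑ s, l s * setCoeff G s (.inl p) = x.1 p.1 p.2 :=
    fun p => hl.sum_single p
  -- The average is half of ∑ (x_u(i) + x_v(i) - 2 min) = 1 - ∑ min, and the diagonal entries equal
  -- these minima because `x` is in L*(G).
  have hedge : ∀ e, ∑ s, l s * setCoeff G s (.inr e) = 1 - ∑ i, x.2 e i i := by
    intro e
    simp only [setCoeff, Sum.elim_inr, mul_div_assoc', Finset.mul_sum, mul_add, mul_sub]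
    rw [← Finset.sum_div, Finset.sum_comm]
    simp only [Finset.sum_add_distrib, Finset.sum_sub_distrib, mul_left_comm _ (2 : ℝ),
      ← Finset.mul_sum, hl.sum_single, hl.sum_pair, hx.2, hx.1.1]
    ring
  rw [dot_sub_dot hx.1]
  simp only [Fintype.sum_sum_type, Sum.elim_inl, Sum.elim_inr, mul_add, Finset.mul_sum,
    Finset.sum_add_distrib]
  rw [Finset.sum_comm (t := Finset.univ (α := V × L)),
    Finset.sum_comm (t := Finset.univ (α := G.edgeSet)), Fintype.sum_prod_type]
  congr 1
  · refine Finset.sum_congr rfl fun u _ => Finset.sum_congr rfl fun i _ => ?_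
    rw [show x.1 u i = _ from (hnode (u, i)).symm, Finset.mul_sum]
    exact Finset.sum_congr rfl fun s _ => by ring
  · refine Finset.sum_congr rfl fun e _ => ?_
    rw [← hedge e, Finset.mul_sum]
    exact Finset.sum_congr rfl fun s _ => by ring

theorem objDist_le_of_setCoeff {c c' : V → L → ℝ} {w w' : G.edgeSet → ℝ} {B : ℝ} (hB : 0 ≤ B)
    (h : ∀ s, |∑ p, setCoeff G s p *
      Sum.elim (fun p : V × L => c' p.1 p.2 - c p.1 p.2) (fun e => w' e - w e) p| ≤ B) :
    objDist (objVec c' w') (objVec c w) ≤ B := by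
  classical
  refine (objDist_le_iff hB).2 fun x hx => ?_
  obtain ⟨l, hl⟩ := exists_isThresholdWeights (fun p : V × L => x.1 p.1 p.2)
    fun p => hx.1.2.2.2.2 p.1 p.2
  rw [dot_sub_dot_eq_sum hx hl]
  calc _ ≤ ∑ s, l s * B := by
        refine (Finset.abs_sum_le_sum_abs _ _).trans (Finset.sum_le_sum fun s _ => ?_)
        rw [abs_mul, abs_of_nonneg (hl.nonneg s)]
        exact mul_le_mul_of_nonneg_left (h s) (hl.nonneg s)
    _ = B := by rw [← Finset.sum_mul, hl.sum_eq_one, one_mul]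

variable {Ω : Type*} [MeasurableSpace Ω] {μ : Measure Ω} {cbar : V → L → ℝ}
  {wbar : G.edgeSet → ℝ} {ct : V → L → Ω → ℝ} {wt : G.edgeSet → Ω → ℝ}

/-- Although L*(G) may be uncountable, the condition is an intersection of closed conditions on the
finite-dimensional noise vector, hence closed. -/
theorem measurableSet_closeEvent (hct : ∀ u i, Measurable (ct u i)) (hwt : ∀ e, Measurable (wt e))
    {B : ℝ} (hB : 0 ≤ B) : MeasurableSet (closeEvent cbar wbar ct wt B) := by
  let K : Set ((V → L → ℝ) × (G.edgeSet → ℝ)) := {q | ∀ x ∈ Lstar G L,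
    |(∑ u, ∑ i, q.1 u i * x.1 u i) + ∑ e, q.2 e * (1 - ∑ i, x.2 e i i)| ≤ B}
  have hK : IsClosed K := by
    simp only [K, Set.ofPred_forall]
    refine isClosed_biInter fun x _ => isClosed_le ?_ continuous_const
    fun_prop
  have hF : Measurable fun ω => ((fun u i => ct u i ω, fun e => wt e ω) :
      (V → L → ℝ) × (G.edgeSet → ℝ)) :=
    (measurable_pi_lambda _ fun u => measurable_pi_lambda _ fun i => hct u i).prodMk
      (measurable_pi_lambda _ fun e => hwt e)
  convert hF hK.measurableSet
  ext ω
  rw [closeEvent, Set.mem_ofPred_eq, objDist_le_iff hB]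
  refine forall₂_congr fun x hx => ?_
  rw [dot_sub_dot hx.1]
  simp [observedCost, observedWeight]

/-- Every form has variance proxy at most `S`, so it exceeds B = c√(nk)·√S in absolute value with
probability at most 2 exp(-c²nk/2). The union over 2^(nk) sets supplies the term nk ln 2. -/
theorem IsNoise.le_measureReal_closeEvent [IsProbabilityMeasure μ] {σ : V → L → ℝ≥0}
    {γ : G.edgeSet → ℝ≥0} (h : IsNoise μ ct wt σ γ) {c : ℝ} (hc : 0 ≤ c) :
    1 - 2 * Real.exp ((Fintype.card V : ℝ) * Fintype.card L * (Real.log 2 - c ^ 2 / 2))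
      ≤ μ.real (closeEvent cbar wbar ct wt (noiseBound c σ γ)) := by
  classical
  set N : ℝ := (Fintype.card V : ℝ) * Fintype.card L with hN
  have hN0 : 0 ≤ N := by positivity
  set S : ℝ := (∑ u, ∑ i, (σ u i : ℝ) ^ 2) +
    (Fintype.card L : ℝ) ^ 2 / 4 * ∑ e, (γ e : ℝ) ^ 2 with hS
  let X : V × L ⊕ G.edgeSet → Ω → ℝ := Sum.elim (fun p : V × L => ct p.1 p.2) wt
  let E : (V × L → Bool) → Set Ω := fun s =>
    {ω | c * √N * √S < |∑ p, setCoeff G s p * X p ω|}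
  have hE : ∀ s, μ.real (E s) ≤ 2 * Real.exp (-(c * √N) ^ 2 / 2) := by
    intro s
    refine measureReal_lt_abs_le_of_hasSubgaussianMGF (hasSubgaussianMGF_sum_mul
      (v := Sum.elim (fun p : V × L => σ p.1 p.2 ^ 2) fun e => γ e ^ 2) h.indep ?_
      (setCoeff G s)) ?_ (by positivity)
    · rintro (p | e)
      · exact h.subGaussian_cost p.1 p.2
      · exact h.subGaussian_weight e
    · simp only [Fintype.sum_sum_type, Sum.elim_inl, Sum.elim_inr, NNReal.coe_add,
        NNReal.coe_sum, NNReal.coe_mul, NNReal.coe_mk, NNReal.coe_pow, hS, Finset.mul_sum]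
      rw [Fintype.sum_prod_type]
      refine add_le_add (Finset.sum_le_sum fun u _ => Finset.sum_le_sum fun i _ => ?_)
        (Finset.sum_le_sum fun e _ => ?_)
      · exact mul_le_of_le_one_left (sq_nonneg _) (setCoeff_inl_sq_le s (u, i))
      · exact mul_le_mul_of_nonneg_right (setCoeff_inr_sq_le s e) (sq_nonneg _)
  have hsub : (closeEvent cbar wbar ct wt (noiseBound c σ γ))ᶜ ⊆ ⋃ s, E s := by
    intro ω hω
    by_contra hnot
    refine hω (objDist_le_of_setCoeff (noiseBound_nonneg hc σ γ) fun s => ?_)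
    simp only [Set.mem_iUnion, not_exists, E, Set.mem_ofPred_eq, not_lt] at hnot
    have hX : Sum.elim (fun p : V × L => observedCost cbar ct ω p.1 p.2 - cbar p.1 p.2)
        (fun e => observedWeight wbar wt ω e - wbar e) = fun p => X p ω := by
      funext p
      rcases p with p | e <;> simp [X, observedCost, observedWeight]
    rw [hX]
    exact hnot s
  have hbound : μ.real (closeEvent cbar wbar ct wt (noiseBound c σ γ))ᶜ ≤
      2 * Real.exp (N * (Real.log 2 - c ^ 2 / 2)) := by
    calc _ ≤ μ.real (⋃ s, E s) := measureReal_mono hsub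
      _ ≤ ∑ s, μ.real (E s) := measureReal_iUnion_fintype_le _
      _ ≤ ∑ _s : V × L → Bool, 2 * Real.exp (-(c * √N) ^ 2 / 2) :=
        Finset.sum_le_sum fun s _ => hE s
      _ = _ := by
        have h2 : ((2 : ℝ) ^ (Fintype.card V * Fintype.card L)) = Real.exp (N * Real.log 2) := by
          rw [hN, ← Nat.cast_mul, Real.exp_nat_mul, Real.exp_log two_pos]
        rw [Finset.sum_const, nsmul_eq_mul, Finset.card_univ, Fintype.card_fun,
          Fintype.card_bool, Fintype.card_prod, Nat.cast_pow, Nat.cast_ofNat, h2,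
          mul_left_comm, ← Real.exp_add, mul_pow, Real.sq_sqrt hN0]
        ring_nf
  rw [probReal_compl_eq_one_sub (measurableSet_closeEvent h.measurable_cost h.measurable_weight
    (noiseBound_nonneg hc σ γ))] at hbound
  linarith

end Concentration

end UniformMetricLabeling

end

theorem mainTheorem3 {V L : Type*} [Fintype V] [Fintype L] [DecidableEq L]
    (G : SimpleGraph V) [Fintype G.edgeSet]
    {Ω : Type*} [MeasurableSpace Ω] (μ : Measure Ω) [IsProbabilityMeasure μ]
    (cbar : V → L → ℝ) (wbar : G.edgeSet → ℝ) (hwbar : ∀ e, 0 ≤ wbar e)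
    (ψ : ℝ) (hψ : 0 < ψ)
    (hstable : UniformMetricLabeling.ExpansionStableMargin cbar wbar ψ)
    (ct : V → L → Ω → ℝ) (wt : G.edgeSet → Ω → ℝ)
    (σ : V → L → ℝ≥0) (γ : G.edgeSet → ℝ≥0)
    (hnoise : UniformMetricLabeling.IsNoise μ ct wt σ γ)
    (c : ℝ) (hc : 0 ≤ c) :
    MeasurableSet (UniformMetricLabeling.closeEvent cbar wbar ct wt
      (UniformMetricLabeling.noiseBound c σ γ)) ∧
    1 - 2 * Real.exp ((Fintype.card V : ℝ) * Fintype.card L * (Real.log 2 - c ^ 2 / 2))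
      ≤ μ.real (UniformMetricLabeling.closeEvent cbar wbar ct wt
          (UniformMetricLabeling.noiseBound c σ γ)) ∧
    ((∀ e, ∀ᵐ ω ∂μ, 0 ≤ UniformMetricLabeling.observedWeight wbar wt ω e) →
      ∀ᵐ ω ∂μ, ω ∈ UniformMetricLabeling.closeEvent cbar wbar ct wt
          (UniformMetricLabeling.noiseBound c σ γ) →
        ∀ (xhat : UniformMetricLabeling.Point G L) (ybar yhat : V → L),
          UniformMetricLabeling.IsLPSolution (UniformMetricLabeling.observedCost cbar ct ω)
            (UniformMetricLabeling.observedWeight wbar wt ω) xhat →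
          UniformMetricLabeling.IsMAP cbar wbar ybar →
          UniformMetricLabeling.IsMAP (UniformMetricLabeling.observedCost cbar ct ω)
            (UniformMetricLabeling.observedWeight wbar wt ω) yhat →
          UniformMetricLabeling.nodeDist xhat (UniformMetricLabeling.ofLabeling G ybar)
              ≤ 2 / ψ * UniformMetricLabeling.noiseBound c σ γ ∧
          UniformMetricLabeling.nodeDist xhat (UniformMetricLabeling.ofLabeling G yhat)
              ≤ 2 / ψ * UniformMetricLabeling.noiseBound c σ γ
                + UniformMetricLabeling.nodeDist (UniformMetricLabeling.ofLabeling G yhat)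
                    (UniformMetricLabeling.ofLabeling G ybar)) := by
  classical
  refine ⟨UniformMetricLabeling.measurableSet_closeEvent hnoise.measurable_cost
    hnoise.measurable_weight (UniformMetricLabeling.noiseBound_nonneg hc σ γ),
    hnoise.le_measureReal_closeEvent hc, fun hnonneg => ?_⟩
  -- There are finitely many edges, so one null set serves them all; the rest is pointwise, and the
  -- second bound is the triangle inequality through the latent MAP solution.
  filter_upwards [ae_all_iff.2 hnonneg] with ω hω hclose xhat ybar yhat hx hy _
  have h := hstable.nodeDist_lpSolution_le hwbar hψ hy hω hclose hx
  exact ⟨h, (UniformMetricLabeling.nodeDist_triangle _ _ _).trans (add_le_add_left h _)⟩
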